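/- Let $k$ be a field of characteristic zero, let $m\ge 2$, and let $R$ be the polynomial ring over $k$ in the $m^2-1$ variables $x_{i,j}$, $1\le i,j\le m$, $(i,j)\ne(m,m)$. Let $\mathcal{GC}$ be the $m\times m$ matrix whose $(i,j)$ entry is $x_{i,j}$ for $(i,j)\neq(m,m)$ and whose $(m,m)$ entry is $x_{m-1,m-1}$, and let $f=\det\mathcal{GC}\in R$. Then: (i) $f$ is irreducible in $R$. (ii) The Hessian determinant of $f$, i.e. the determinant of the $(m^2-1)\times(m^2-1)$ matrix of second partial derivatives of $f$, is a nonzero polynomial. (iii) The gradient ideal $J\subset R$ of $f$, generated by the partial derivatives of $f$, has linear rank $m^2-2$, the maximum possible. Here, for an ideal minimally generated by $n+1$ forms of the same degree, the linear rank is the rank of the submodule of $R^{n+1}$ generated by those syzygies of a minimal system of such generators whose coordinates are all linear forms (or zero); it does not depend on the system. It is maximal if it equals $n$, the rank of the whole syzygy module. (iv) $f$ is homaloidal, i.e. $f$ is a form of degree at least $2$ and its polar map $\mathbb{P}^{m^2-2}_k\dashrightarrow\mathbb{P}^{m^2-2}_k$, whose coordinates are the partial derivatives of $f$, is a Cremona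 map (a birational map of $\mathbb{P}^{m^2-2}_k$ to itself). -/

import Mathlib

open MvPolynomial

noncomputable section

namespace Cloning

/-! ### Minimal systems of forms and the linear rank of an ideal -/

/-- `g` is a minimal system of generators of the ideal `I`, consisting of forms of the
same degree `s`. -/
structure IsMinimalFormSystem {k σ ι : Type*} [Field k]
    (I : Ideal (MvPolynomial σ k)) (s : ℕ) (g : ι → MvPolynomial σ k) : Prop where
  isHomogeneous : ∀ i, (g i).IsHomogeneous s
  span_eq : Ideal.span (Set.range g) = I
  irredundant : ∀ i, g i ∉ Ideal.span (g '' {j | j ≠ i})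

/-- The module of (first) syzygies of the family `g`. -/
def syzygies {k σ ι : Type*} [Field k] [Fintype ι] (g : ι → MvPolynomial σ k) :
    Submodule (MvPolynomial σ k) (ι → MvPolynomial σ k) :=
  LinearMap.ker (Fintype.linearCombination (MvPolynomial σ k) g)

/-- The submodule generated by the linear syzygies of `g`, i.e. by the syzygies all of whose
coordinates are linear forms (or zero). -/
def linearSyzygies {k σ ι : Type*} [Field k] [Fintype ι] (g : ι → MvPolynomial σ k) :
    Submodule (MvPolynomial σ k) (ι → MvPolynomial σ k) :=
  Submodule.span (MvPolynomial σ k) {c | c ∈ syzygies g ∧ ∀ i, (c i).IsHomogeneous 1}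

/-- The ideal `I`, which is minimally generated by finitely many forms of the same degree, has
linear rank `r`: for each such minimal system of generators the module generated by the linear
syzygies has rank `r`. -/
def HasLinearRank {k σ : Type*} [Field k] (I : Ideal (MvPolynomial σ k)) (r : ℕ) : Prop :=
  (∃ (n s : ℕ) (g : Fin n → MvPolynomial σ k), IsMinimalFormSystem I s g) ∧
    ∀ (n s : ℕ) (g : Fin n → MvPolynomial σ k), IsMinimalFormSystem I s g →
      Module.finrank (MvPolynomial σ k) (linearSyzygies g) = r

/-- The ideal `I` has maximal linear rank: it is minimally generated by `n + 1` forms of the same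
degree, and its linear rank is `n`, the rank of the whole syzygy module. -/
def HasMaximalLinearRank {k σ : Type*} [Field k] (I : Ideal (MvPolynomial σ k)) : Prop :=
  ∃ (n s : ℕ) (g : Fin (n + 1) → MvPolynomial σ k), IsMinimalFormSystem I s g ∧
    Module.finrank (MvPolynomial σ k) (syzygies g) = n ∧ HasLinearRank I n

/-! ### Rational maps between projective spaces -/

/-- `F` is a tuple of forms in the variables `σ`, of the same degree at least one and not all
zero: it defines a rational map from the projective space with coordinates `σ` to the one with
coordinates `τ`. -/
def DefinesRationalMap {k σ τ : Type*} [Field k] (F : τ → MvPolynomial σ k) : Prop :=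
  ∃ d : ℕ, 1 ≤ d ∧ (∀ i, (F i).IsHomogeneous d) ∧ ∃ i, F i ≠ 0

/-- The defining ideal of the image of `F`: the kernel of `k[y] → k[F]`, `y i ↦ F i`. -/
def imageIdeal {k σ τ : Type*} [Field k] (F : τ → MvPolynomial σ k) :
    Ideal (MvPolynomial τ k) :=
  RingHom.ker (aeval F : MvPolynomial τ k →ₐ[k] MvPolynomial σ k)

/-- `F` is birational onto its image: there is a rational map `G`, whose coordinates do not all
vanish modulo the ideal of the image, with `(G(F)) = (x)` as points of projective space. -/
def IsBirationalOntoImage {k σ τ : Type*} [Field k] (F : τ → MvPolynomial σ k) : Prop :=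
  DefinesRationalMap F ∧
    ∃ G : σ → MvPolynomial τ k, DefinesRationalMap G ∧ (∃ i, G i ∉ imageIdeal F) ∧
      ∀ i j, aeval F (G i) * X j = aeval F (G j) * X i

/-- `F` is a Cremona map: a birational map from a projective space to itself, i.e. birational onto
its image, the image being the whole space. -/
def IsCremona {k σ : Type*} [Field k] (F : σ → MvPolynomial σ k) : Prop :=
  IsBirationalOntoImage F ∧ imageIdeal F = ⊥

/-! ### Polar maps -/

/-- The partial derivatives of `f`, the coordinates of its polar map. -/
def polarMap {k σ : Type*} [Field k] (f : MvPolynomial σ k) : σ → MvPolynomial σ k :=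
  fun i => pderiv i f

/-- The gradient (Jacobian) ideal of `f`. -/
def gradientIdeal {k σ : Type*} [Field k] (f : MvPolynomial σ k) : Ideal (MvPolynomial σ k) :=
  Ideal.span (Set.range (polarMap f))

/-- The Hessian matrix of `f`. -/
def hessian {k σ : Type*} [Field k] (f : MvPolynomial σ k) : Matrix σ σ (MvPolynomial σ k) :=
  Matrix.of fun i j => pderiv i (pderiv j f)

/-- `f` is homaloidal: a form of degree at least two whose polar map is a Cremona map. -/
def IsHomaloidal {k σ : Type*} [Field k] (f : MvPolynomial σ k) : Prop :=
  (∃ d : ℕ, 2 ≤ d ∧ f.IsHomogeneous d) ∧ IsCremona (polarMap f)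

/-! ### The cloned generic matrix -/

/-- The index set of the variables: all positions of an `m × m` matrix but the last diagonal one.
Positions are counted from zero. -/
abbrev CloneVar (m : ℕ) : Type :=
  {p : Fin m × Fin m // ¬ (p.1.val + 1 = m ∧ p.2.val + 1 = m)}

/-- The last but one position on the diagonal. -/
def cloneSource (m : ℕ) (hm : 2 ≤ m) : CloneVar m :=
  ⟨(⟨m - 2, by omega⟩, ⟨m - 2, by omega⟩), by
    rintro ⟨h, -⟩
    have h' : m - 2 + 1 = m := h
    omega⟩

/-- The generic `m × m` matrix in which the last but one diagonal entry is cloned into the last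
diagonal slot. -/
def clonedMatrix (k : Type*) [Field k] (m : ℕ) (hm : 2 ≤ m) :
    Matrix (Fin m) (Fin m) (MvPolynomial (CloneVar m) k) :=
  Matrix.of fun i j =>
    if h : i.val + 1 = m ∧ j.val + 1 = m then X (cloneSource m hm) else X ⟨(i, j), h⟩

/-- The determinant of the cloned generic matrix. -/
def clonedDet (k : Type*) [Field k] (m : ℕ) (hm : 2 ≤ m) : MvPolynomial (CloneVar m) k :=
  (clonedMatrix k m hm).det

end Cloning

end

open scoped Matrix

namespace Cloning

/-! ### Derivatives -/

/-! Write M for the cloned matrix, N for the transpose of its adjugate, and s, l for the last two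
indices. By Jacobi's formula the partial derivatives of f = det M are the entries of N outside (s,s)
and (l,l), together with the sum N_ss + N_ll.

The polar map is inverted by recovering N from these data. Since adj N = f^(m-2) Mᵀ and M_ss = M_ll,
the cofactors of N at (s,s) and (l,l) agree. They are affine in N_ll and N_ss respectively, with the
same coefficient Δ, the minor of N without rows and columns s and l. Hence Δ(N_ss - N_ll) is a
polynomial in the known entries, so 2ΔN is known (`balancedMatrix_polar`). Its adjugate is a
multiple of Mᵀ, so the composite is h·x with h = (2Δ)^(m-1) f^(m-2), nonzero because Δ is 1 at M = 1
(`aeval_polar_inversePolar`).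

From this identity, the chain rule and Euler's formula give a nonzero Hessian
(`jacobian_det_ne_zero`). In characteristic zero the partials are then algebraically independent
(`aeval_injective_of_jacobian`), so the polar map is dominant and the partials minimally generate
the gradient ideal.

Linear syzygies come from tr((PM + MQ) adj M) = f·(tr P + tr Q) with scalar P, Q. If the traces
cancel and PM + MQ has equal entries in the cloned slots, those entries form a syzygy. At M = 1 it
specializes to P + Q, which yields m² - 2 independent ones (`exists_linear_syzygy_dual`).

Irreducibility: f is linear in its upper right variable, whose coefficient is up to sign a generic
determinant not dividing the remaining term (`irreducible_det_of_corner`). -/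

theorem derivation_prod {k A ι : Type*} [CommSemiring k] [CommRing A] [Algebra k A]
    [DecidableEq ι] (D : Derivation k A A) (s : Finset ι) (a : ι → A) :
    D (∏ i ∈ s, a i) = ∑ i ∈ s, ∏ j ∈ s, if j = i then D (a j) else a j := by
  induction s using Finset.induction_on with
  | empty => simp
  | insert b s hb ih =>
    have h1 : ∀ i ∈ s, (∏ j ∈ insert b s, if j = i then D (a j) else a j)
        = a b * ∏ j ∈ s, if j = i then D (a j) else a j := by
      intro i hi
      rw [Finset.prod_insert hb, if_neg]
      rintro rfl
      exact hb hi
    have h2 : (∏ j ∈ s, if j = b then D (a j) else a j) = ∏ j ∈ s, a j := by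
      refine Finset.prod_congr rfl fun j hj => if_neg ?_
      rintro rfl
      exact hb hj
    rw [Finset.prod_insert hb, Derivation.leibniz, Finset.sum_insert hb, Finset.sum_congr rfl h1,
      Finset.prod_insert hb, if_pos rfl, h2, ih, ← Finset.mul_sum, smul_eq_mul, smul_eq_mul]
    ring

/-- Jacobi's formula for a derivation. -/
theorem derivation_det {k A n : Type*} [CommSemiring k] [CommRing A] [Algebra k A] [Fintype n]
    [DecidableEq n] (D : Derivation k A A) (M : Matrix n n A) :
    D M.det = ∑ i, ∑ j, M.adjugate j i * D (M i j) := by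
  have h : D M.det = ∑ j, (M.updateCol j fun i => D (M i j)).det := by
    simp_rw [Matrix.det_apply]
    rw [Finset.sum_comm, map_sum]
    refine Finset.sum_congr rfl fun σ _ => ?_
    rw [← Finset.smul_sum, Units.smul_def, map_zsmul, derivation_prod, ← Units.smul_def]
    congr 1
    refine Finset.sum_congr rfl fun j _ => Finset.prod_congr rfl fun i _ => ?_
    by_cases hij : i = j
    · subst hij; simp
    · simp [hij]
  rw [h, Finset.sum_comm]
  refine Finset.sum_congr rfl fun j _ => ?_
  rw [← Matrix.cramer_apply, Matrix.cramer_eq_adjugate_mulVec]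
  rfl

theorem pderiv_aeval {k σ τ : Type*} [CommRing k] [Fintype τ] (F : τ → MvPolynomial σ k) (j : σ)
    (P : MvPolynomial τ k) :
    pderiv j (aeval F P) = ∑ i, aeval F (pderiv i P) * pderiv j (F i) := by
  classical
  induction P using MvPolynomial.induction_on with
  | C a => simp [MvPolynomial.algebraMap_eq]
  | add p q hp hq => simp only [map_add, hp, hq, add_mul, Finset.sum_add_distrib]
  | mul_X p i hp =>
    simp only [map_mul, aeval_X, Derivation.leibniz, smul_eq_mul, hp, map_add, add_mul,
      Finset.sum_add_distrib, pderiv_X]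
    congr 1
    · rw [Finset.sum_eq_single i]
      · simp
      · intro b _ hb
        simp [hb.symm]
      · simp
    · rw [Finset.mul_sum]
      exact Finset.sum_congr rfl fun _ _ => by ring

/-- If `G ∘ F` is the identity up to a nonzero homogeneous factor, then the Jacobian determinant
of `F` does not vanish. -/
theorem jacobian_det_ne_zero {k σ : Type*} [Field k] [CharZero k] [Fintype σ] [DecidableEq σ]
    {F G : σ → MvPolynomial σ k} {h : MvPolynomial σ k} {e : ℕ} (h0 : h ≠ 0)
    (he : h.IsHomogeneous e) (hG : ∀ i, aeval F (G i) = h * X i) :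
    (Matrix.of fun i j => pderiv i (F j)).det ≠ 0 := by
  rw [← Matrix.det_transpose]
  intro hdet
  obtain ⟨v, hv0, hv⟩ := Matrix.exists_mulVec_eq_zero_iff.mpr hdet
  have hv' : ∀ i, ∑ j, pderiv j (F i) * v j = 0 := fun i => congrFun hv i
  -- Differentiate G(F) = h·x along v; the left side contributes nothing because v lies in the
  -- kernel of the Jacobian matrix of F.
  have key : ∀ i, h * v i + X i * ∑ j, pderiv j h * v j = 0 := by
    intro i
    have h1 : ∑ j, pderiv j (aeval F (G i)) * v j = 0 := by
      simp_rw [pderiv_aeval, Finset.sum_mul, mul_assoc]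
      rw [Finset.sum_comm]
      refine Finset.sum_eq_zero fun l _ => ?_
      rw [← Finset.mul_sum, hv', mul_zero]
    simp_rw [hG, Derivation.leibniz, pderiv_X, smul_eq_mul, add_mul] at h1
    rw [Finset.sum_add_distrib] at h1
    rw [← h1, Finset.mul_sum]
    congr 1
    · rw [Finset.sum_eq_single i]
      · simp
      · intro b _ hb
        simp [hb.symm]
      · simp
    · exact Finset.sum_congr rfl fun _ _ => by ring
  -- Pairing with the gradient of h and applying Euler's formula leaves (e + 1)·h·∂ᵥh, which forces
  -- ∂ᵥh = 0.
  have h2 : ∑ i, pderiv i h * (h * v i + X i * ∑ j, pderiv j h * v j) = 0 := by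
    simp [key]
  have h3 : ∑ i, pderiv i h * (h * v i + X i * ∑ j, pderiv j h * v j)
      = ((e + 1 : ℕ) : MvPolynomial σ k) * (h * ∑ j, pderiv j h * v j) := by
    have := he.sum_X_mul_pderiv
    rw [nsmul_eq_mul] at this
    simp_rw [mul_add]
    rw [Finset.sum_add_distrib]
    simp_rw [← mul_assoc]
    rw [← Finset.sum_mul]
    simp_rw [mul_comm (pderiv _ h) (X _), this, mul_comm (pderiv _ h) h, mul_assoc]
    rw [← Finset.mul_sum]
    push_cast
    ring
  have hw : ∑ j, pderiv j h * v j = 0 := by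
    rw [h3] at h2
    have : ((e + 1 : ℕ) : MvPolynomial σ k) ≠ 0 := Nat.cast_ne_zero.mpr (Nat.succ_ne_zero e)
    simpa only [mul_eq_zero, this, h0, false_or] using h2
  apply hv0
  funext i
  simpa [hw, h0] using key i

theorem eq_C_of_pderiv_eq_zero {k σ : Type*} [Field k] [CharZero k]
    {P : MvPolynomial σ k} (h : ∀ i, pderiv i P = 0) : P = C (coeff 0 P) := by
  classical
  ext d
  rw [coeff_C]
  split_ifs with hd
  · rw [← hd]
  · obtain ⟨i, hi⟩ : ∃ i, d i ≠ 0 := by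
      by_contra! hc
      exact hd (Finsupp.ext fun i => (hc i).symm)
    have h1 := congrArg (coeff (d - Finsupp.single i 1)) (h i)
    have h2 : d - Finsupp.single i 1 + Finsupp.single i 1 = d :=
      tsub_add_cancel_of_le (by
        intro j
        rw [Finsupp.single_apply]
        split_ifs with hj
        · subst hj; omega
        · omega)
    rw [coeff_pderiv, h2, coeff_zero] at h1
    rcases mul_eq_zero.mp h1 with h1 | h1
    · exact h1
    · exfalso
      norm_cast at h1

/-- In characteristic zero, forms with a nonzero Jacobian determinant are algebraically
independent. -/
theorem aeval_injective_of_jacobian {k σ : Type*} [Field k] [CharZero k] [Fintype σ]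
    [DecidableEq σ] {F : σ → MvPolynomial σ k}
    (hF : (Matrix.of fun i j => pderiv i (F j)).det ≠ 0) (P : MvPolynomial σ k)
    (hP : aeval F P = 0) : P = 0 := by
  induction hn : P.totalDegree using Nat.strong_induction_on generalizing P with
  | _ n ih =>
  have h1 : ∀ i, aeval F (pderiv i P) = 0 := by
    have h2 : (Matrix.of fun i j => pderiv i (F j)).mulVec (fun i => aeval F (pderiv i P)) = 0 := by
      funext j
      have := pderiv_aeval F j P
      rw [hP, map_zero] at this
      simp only [Matrix.mulVec, dotProduct, Matrix.of_apply, Pi.zero_apply]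
      rw [this]
      exact Finset.sum_congr rfl fun _ _ => mul_comm _ _
    intro i
    by_contra hi
    exact hF (Matrix.exists_mulVec_eq_zero_iff.mp ⟨_, fun h => hi (congrFun h i), h2⟩)
  -- Each partial derivative of P is again a relation among the F's, of smaller degree if nonzero,
  -- so the induction hypothesis kills it.
  have h3 : ∀ i, pderiv i P = 0 := by
    intro i
    by_contra hi
    refine hi (ih _ ?_ _ (h1 i) rfl)
    rw [← hn]
    by_contra! hle
    obtain ⟨d, hd, hdeg⟩ := Finset.exists_mem_eq_sup _ (support_nonempty.mpr hi)
      fun s : σ →₀ ℕ => s.degree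
    have hd' : coeff d (pderiv i P) ≠ 0 := mem_support_iff.mp hd
    rw [coeff_pderiv] at hd'
    have h4 : d + Finsupp.single i 1 ∈ P.support :=
      mem_support_iff.mpr (left_ne_zero_of_mul hd')
    have h5 := le_totalDegree h4
    have h6 : (pderiv i P).totalDegree = d.degree := hdeg
    have h7 : (d + Finsupp.single i 1).degree = d.degree + 1 := by simp
    have h8 : ((d + Finsupp.single i 1).sum fun _ e => e) = (d + Finsupp.single i 1).degree := rfl
    omega
  have h4 := eq_C_of_pderiv_eq_zero h3
  rw [h4] at hP ⊢
  rw [aeval_C, MvPolynomial.algebraMap_eq] at hP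
  exact hP

/-! ### Determinants of matrices of forms -/

theorem isHomogeneous_det {k σ n : Type*} [CommRing k] [Fintype n] [DecidableEq n]
    {M : Matrix n n (MvPolynomial σ k)} {d : n → ℕ} (h : ∀ i j, (M i j).IsHomogeneous (d i)) :
    M.det.IsHomogeneous (∑ i, d i) := by
  rw [← Matrix.det_transpose, Matrix.det_apply']
  refine IsHomogeneous.sum _ _ _ fun σ _ => ?_
  rw [← zero_add (∑ i, d i)]
  refine IsHomogeneous.mul ?_ (IsHomogeneous.prod _ _ _ fun i _ => h _ _)
  rw [← map_intCast (C : k →+* MvPolynomial _ k)]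
  exact isHomogeneous_C _ _

theorem isHomogeneous_single {k σ n : Type*} [CommRing k] [DecidableEq n] (i j : n) :
    ((Pi.single i 1 : n → MvPolynomial σ k) j).IsHomogeneous 0 := by
  rw [Pi.single_apply]
  split_ifs
  · exact isHomogeneous_one _ _
  · exact isHomogeneous_zero _ _ _

theorem det_mem_subalgebra {k A n : Type*} [CommRing k] [CommRing A] [Algebra k A] [Fintype n]
    [DecidableEq n] (S : Subalgebra k A) {M : Matrix n n A} (h : ∀ i j, M i j ∈ S) : M.det ∈ S := by
  rw [Matrix.det_apply]
  refine sum_mem fun σ _ => ?_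
  rw [Units.smul_def]
  exact zsmul_mem (prod_mem fun i _ => h _ _) _

/-! ### Irreducibility -/

/-- Linearity in row i isolates the dependence on one entry. This serves both the corner variable in
the irreducibility argument and the diagonal entries of N in the inversion. -/
theorem det_eq_mul_adjugate_add {A n : Type*} [CommRing A] [Fintype n] [DecidableEq n]
    (M : Matrix n n A) (i j : n) :
    M.det = M.adjugate j i * M i j + (M.updateRow i (Function.update (M i) j 0)).det := by
  have h : M i = M i j • Pi.single j 1 + Function.update (M i) j 0 := by
    funext l
    by_cases hl : l = j
    · subst hl; simp
    · simp [hl]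
  conv_lhs => rw [← Matrix.updateRow_eq_self M i, h]
  rw [Matrix.det_updateRow_add, Matrix.det_updateRow_smul, Matrix.adjugate_apply, mul_comm]

/-- A determinant of variables is irreducible as soon as its upper right corner occurs only once,
the complementary minor is irreducible, and the matrix can be specialized to the identity. -/
theorem irreducible_det_of_corner {k σ : Type*} [Field k] {n : ℕ}
    (e : Fin (n + 2) → Fin (n + 2) → σ)
    (he : ∀ i j, e i j = e 0 (Fin.last _) → i = 0 ∧ j = Fin.last _)
    (v : σ → k) (hv : ∀ i j, v (e i j) = if i = j then 1 else 0)
    (hD : Irreducible (Matrix.of fun i j : Fin (n + 1) =>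
      (X (e i.succ j.castSucc) : MvPolynomial σ k)).det) :
    Irreducible (Matrix.of fun i j => (X (e i j) : MvPolynomial σ k)).det := by
  set M : Matrix (Fin (n + 2)) (Fin (n + 2)) (MvPolynomial σ k) :=
    Matrix.of fun i j => X (e i j) with hM
  set D := (Matrix.of fun i j : Fin (n + 1) =>
      (X (e i.succ j.castSucc) : MvPolynomial σ k)).det with hDdef
  set x := e 0 (Fin.last _) with hx
  have hadj : M.adjugate (Fin.last _) 0 = (-1) ^ (n + 1) * D := by
    rw [Matrix.adjugate_fin_succ_eq_det_submatrix]
    have h : M.submatrix (Fin.succAbove 0) (Fin.succAbove (Fin.last _))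
        = Matrix.of fun i j : Fin (n + 1) => (X (e i.succ j.castSucc) : MvPolynomial σ k) := by
      ext1 i j
      simp [hM]
    rw [h]
    simp [hDdef]
  set E := (M.updateRow 0 (Function.update (M 0) (Fin.last _) 0)).det with hE
  have hdet : M.det = ((-1) ^ (n + 1) * D) * X x + E := by
    rw [← hadj]
    exact det_eq_mul_adjugate_add M 0 (Fin.last _)
  have hunit : IsUnit ((-1 : MvPolynomial σ k) ^ (n + 1)) := (isUnit_one.neg).pow _
  have hvars : ∀ p : MvPolynomial σ k, p ∈ supported k ({x}ᶜ : Set σ) → x ∉ p.vars := by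
    intro p hp hmem
    exact (mem_supported.mp hp hmem) rfl
  have hDs : D ∈ supported k ({x}ᶜ : Set σ) := by
    refine det_mem_subalgebra _ fun i j => X_mem_supported.mpr fun h => ?_
    exact Fin.succ_ne_zero i (he _ _ h).1
  have hEs : E ∈ supported k ({x}ᶜ : Set σ) := by
    refine det_mem_subalgebra _ fun i j => ?_
    by_cases hij : i = 0 ∧ j = Fin.last _
    · rw [hij.1, hij.2]
      simp
    · have : M.updateRow 0 (Function.update (M 0) (Fin.last _) 0) i j = X (e i j) := by
        by_cases hi : i = 0
        · subst hi
          have hj : j ≠ Fin.last _ := fun h => hij ⟨rfl, h⟩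
          simp [hj, hM]
        · simp [hi, hM]
      rw [this]
      exact X_mem_supported.mpr fun h => hij (he _ _ h)
  -- At the identity matrix, deleting row 0 and the last column leaves a zero last row. Then E takes
  -- the value 1 there, so D cannot divide E.
  have hDv : aeval v D = 0 := by
    rw [hDdef, AlgHom.map_det]
    refine Matrix.det_eq_zero_of_row_eq_zero (Fin.last n) fun j => ?_
    have : (Fin.last n).succ ≠ j.castSucc := by
      rw [Fin.succ_last]
      exact (Fin.castSucc_lt_last j).ne'
    simp only [AlgHom.mapMatrix_apply, Matrix.map_apply, Matrix.of_apply, aeval_X, hv, if_neg this]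
  have hEv : aeval v E = 1 := by
    have h1 : aeval v M.det = 1 := by
      rw [AlgHom.map_det]
      convert Matrix.det_one (n := Fin (n + 2)) (R := k)
      ext i j
      simp [hM, hv, Matrix.one_apply]
    rw [hdet] at h1
    rwa [map_add, map_mul, map_mul, hDv, mul_zero, zero_mul, zero_add] at h1
  rw [hdet]
  refine irreducible_mul_X_add _ _ _ (mul_ne_zero hunit.ne_zero hD.ne_zero) (hvars _ ?_)
    (hvars _ hEs) ?_
  · exact mul_mem (pow_mem (neg_mem (one_mem _)) _) hDs
  · rw [isRelPrime_mul_unit_left_left hunit, hD.isRelPrime_iff_not_dvd]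
    rintro ⟨c, hc⟩
    rw [hc, map_mul, hDv, zero_mul] at hEv
    exact zero_ne_one hEv

/-- The generic determinant is irreducible. -/
theorem irreducible_det_of_injective {k σ : Type*} [Field k] (n : ℕ)
    (e : Fin (n + 1) → Fin (n + 1) → σ)
    (he : ∀ i j i' j', e i j = e i' j' → i = i' ∧ j = j') :
    Irreducible (Matrix.of fun i j => (X (e i j) : MvPolynomial σ k)).det := by
  classical
  induction n with
  | zero =>
    rw [Matrix.det_fin_one]
    exact X_prime.irreducible
  | succ n ih =>
    refine irreducible_det_of_corner e (fun i j h => he _ _ _ _ h)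
      (fun x => if ∃ i, x = e i i then 1 else 0) ?_ (ih _ ?_)
    · intro i j
      refine if_congr ⟨?_, ?_⟩ rfl rfl
      · rintro ⟨l, hl⟩
        obtain ⟨rfl, rfl⟩ := he _ _ _ _ hl
        rfl
      · rintro rfl
        exact ⟨i, rfl⟩
    · intro i j i' j' h
      obtain ⟨h1, h2⟩ := he _ _ _ _ h
      exact ⟨Fin.succ_injective _ h1, Fin.castSucc_injective _ h2⟩

/-! ### The cloned matrix -/

/-- The variable in position `(i, j)` of the cloned matrix. -/
def cloneIndex (m : ℕ) (hm : 2 ≤ m) (i j : Fin m) : CloneVar m :=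
  if h : i.val + 1 = m ∧ j.val + 1 = m then cloneSource m hm else ⟨(i, j), h⟩

theorem clonedMatrix_eq (k : Type*) [Field k] (m : ℕ) (hm : 2 ≤ m) :
    clonedMatrix k m hm = Matrix.of fun i j => X (cloneIndex m hm i j) := by
  ext1 i j
  simp only [clonedMatrix, cloneIndex, Matrix.of_apply]
  split_ifs <;> rfl

theorem cloneIndex_val {m : ℕ} (hm : 2 ≤ m) (p : CloneVar m) :
    cloneIndex m hm p.1.1 p.1.2 = p := by
  rw [cloneIndex, dif_neg p.2]

theorem cloneIndex_of_ne {m : ℕ} (hm : 2 ≤ m) {i j : Fin m}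
    (h : ¬(i.val + 1 = m ∧ j.val + 1 = m)) : cloneIndex m hm i j = ⟨(i, j), h⟩ :=
  dif_neg h

/-- The coordinates of the identity matrix. -/
def idPoint (k : Type*) [Field k] (m : ℕ) (p : CloneVar m) : k := if p.1.1 = p.1.2 then 1 else 0

theorem idPoint_cloneIndex (k : Type*) [Field k] {m : ℕ} (hm : 2 ≤ m) (i j : Fin m) :
    idPoint k m (cloneIndex m hm i j) = if i = j then 1 else 0 := by
  by_cases h : i.val + 1 = m ∧ j.val + 1 = m
  · have hij : i = j := Fin.ext (by omega)
    rw [cloneIndex, dif_pos h, if_pos hij]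
    simp [idPoint, cloneSource]
  · rw [cloneIndex_of_ne hm h]
    rfl

theorem irreducible_clonedDet (k : Type*) [Field k] (m : ℕ) (hm : 2 ≤ m) :
    Irreducible (clonedDet k m hm) := by
  obtain ⟨n, rfl⟩ := Nat.exists_eq_add_of_le' hm
  rw [clonedDet, clonedMatrix_eq]
  refine irreducible_det_of_corner _ ?_ _ (idPoint_cloneIndex k hm)
    (irreducible_det_of_injective _ _ ?_)
  · intro i j h
    have h0 : ¬((0 : Fin (n + 2)).val + 1 = n + 2 ∧ (Fin.last (n + 1)).val + 1 = n + 2) := by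
      simp
    rw [cloneIndex_of_ne hm h0] at h
    by_cases hij : i.val + 1 = n + 2 ∧ j.val + 1 = n + 2
    · rw [cloneIndex, dif_pos hij] at h
      -- The cloned variable sits in column n, the corner variable in column n + 1.
      have h2 := congrArg (fun p : CloneVar (n + 2) => p.1.2.val) h
      simp [cloneSource] at h2
    · rw [cloneIndex_of_ne hm hij] at h
      simpa using h
  · intro i j i' j' h
    -- The complementary minor omits the last column, hence the cloned slot, so its entries are
    -- distinct variables.
    have hlt : ∀ i j : Fin (n + 1),
        ¬(i.succ.val + 1 = n + 2 ∧ j.castSucc.val + 1 = n + 2) := by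
      intro i j
      have := j.isLt
      simp only [Fin.val_castSucc]
      omega
    rw [cloneIndex_of_ne hm (hlt i j), cloneIndex_of_ne hm (hlt i' j')] at h
    simpa using h

/-! ### The partial derivatives of the cloned determinant -/

/-- The last index. -/
def ult (m : ℕ) (hm : 2 ≤ m) : Fin m := ⟨m - 1, by omega⟩

/-- The last but one index. -/
def penult (m : ℕ) (hm : 2 ≤ m) : Fin m := ⟨m - 2, by omega⟩

theorem penult_ne_ult (m : ℕ) (hm : 2 ≤ m) : penult m hm ≠ ult m hm := by
  intro h
  have := congrArg Fin.val h
  simp only [penult, ult] at this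
  omega

theorem cloneIndex_ult (m : ℕ) (hm : 2 ≤ m) :
    cloneIndex m hm (ult m hm) (ult m hm) = cloneSource m hm :=
  dif_pos (by simp only [ult]; omega)

theorem cloneIndex_penult (m : ℕ) (hm : 2 ≤ m) :
    cloneIndex m hm (penult m hm) (penult m hm) = cloneSource m hm :=
  dif_neg (by simp only [penult]; omega)

theorem cloneIndex_eq_source {m : ℕ} (hm : 2 ≤ m) (i j : Fin m) :
    cloneIndex m hm i j = cloneSource m hm ↔
      (i = penult m hm ∧ j = penult m hm) ∨ (i = ult m hm ∧ j = ult m hm) := by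
  constructor
  · intro h
    by_cases hij : i.val + 1 = m ∧ j.val + 1 = m
    · right
      constructor <;> ext <;> simp only [ult] <;> omega
    · left
      rw [cloneIndex_of_ne hm hij, cloneSource] at h
      simpa [penult] using h
  · rintro (⟨rfl, rfl⟩ | ⟨rfl, rfl⟩)
    · exact cloneIndex_penult m hm
    · exact cloneIndex_ult m hm

theorem cloneIndex_eq_iff {m : ℕ} (hm : 2 ≤ m) {p : CloneVar m} (hp : p ≠ cloneSource m hm)
    (i j : Fin m) : cloneIndex m hm i j = p ↔ i = p.1.1 ∧ j = p.1.2 := by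
  constructor
  · rintro rfl
    by_cases hij : i.val + 1 = m ∧ j.val + 1 = m
    · exact absurd (dif_pos hij) hp
    · rw [cloneIndex_of_ne hm hij]
      exact ⟨rfl, rfl⟩
  · rintro ⟨rfl, rfl⟩
    exact cloneIndex_val hm p

section Polar

variable (k : Type*) [Field k] (m : ℕ) (hm : 2 ≤ m)

theorem polarMap_clonedDet (p : CloneVar m) :
    polarMap (clonedDet k m hm) p = ∑ i, ∑ j, (clonedMatrix k m hm).adjugate j i *
      if cloneIndex m hm i j = p then 1 else 0 := by
  rw [polarMap, clonedDet, derivation_det]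
  refine Finset.sum_congr rfl fun i _ => Finset.sum_congr rfl fun j _ => ?_
  conv_lhs => rw [clonedMatrix_eq k m hm]
  rw [Matrix.of_apply, pderiv_X, Pi.single_apply, ← clonedMatrix_eq]

/-- Regrouping by matrix positions turns a combination of partials into a trace against adj M, the
form in which syzygies are produced. -/
theorem sum_mul_polarMap_clonedDet (c : CloneVar m → MvPolynomial (CloneVar m) k) :
    ∑ p, c p * polarMap (clonedDet k m hm) p =
      ∑ i, ∑ j, c (cloneIndex m hm i j) * (clonedMatrix k m hm).adjugate j i := by
  simp_rw [polarMap_clonedDet, Finset.mul_sum]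
  rw [Finset.sum_comm]
  refine Finset.sum_congr rfl fun i _ => ?_
  rw [Finset.sum_comm]
  refine Finset.sum_congr rfl fun j _ => ?_
  rw [Finset.sum_eq_single (cloneIndex m hm i j)]
  · simp
  · intro p _ hp
    rw [if_neg hp.symm, mul_zero, mul_zero]
  · simp

theorem polarMap_clonedDet_of_ne {p : CloneVar m} (hp : p ≠ cloneSource m hm) :
    polarMap (clonedDet k m hm) p = (clonedMatrix k m hm).adjugate p.1.2 p.1.1 := by
  rw [polarMap_clonedDet]
  simp_rw [cloneIndex_eq_iff hm hp, ite_and, mul_ite, mul_one, mul_zero]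
  rw [Finset.sum_eq_single p.1.1 _ (by simp)]
  · simp
  · intro b _ hb
    simp [hb]

theorem polarMap_clonedDet_source :
    polarMap (clonedDet k m hm) (cloneSource m hm) =
      (clonedMatrix k m hm).adjugate (penult m hm) (penult m hm) +
        (clonedMatrix k m hm).adjugate (ult m hm) (ult m hm) := by
  have h : ∀ i j, (if cloneIndex m hm i j = cloneSource m hm then 1 else 0 :
      MvPolynomial (CloneVar m) k) = (if i = penult m hm then if j = penult m hm then 1 else 0 else 0)
        + (if i = ult m hm then if j = ult m hm then 1 else 0 else 0) := by
    intro i j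
    have hne := penult_ne_ult m hm
    simp only [cloneIndex_eq_source]
    by_cases h1 : i = penult m hm
    · subst h1
      simp [hne]
    · simp [h1, ite_and]
  rw [polarMap_clonedDet]
  simp_rw [h, mul_add, Finset.sum_add_distrib]
  congr 1
  · rw [Finset.sum_eq_single (penult m hm) _ (by simp)]
    · simp
    · intro b _ hb
      simp [hb]
  · rw [Finset.sum_eq_single (ult m hm) _ (by simp)]
    · simp
    · intro b _ hb
      simp [hb]

theorem isHomogeneous_clonedDet : (clonedDet k m hm).IsHomogeneous m := by
  have h := isHomogeneous_det (M := clonedMatrix k m hm) (d := fun _ => 1) (fun i j => by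
    rw [clonedMatrix_eq]
    exact isHomogeneous_X _ _)
  simpa [clonedDet] using h

theorem isHomogeneous_polarMap (p : CloneVar m) :
    (polarMap (clonedDet k m hm) p).IsHomogeneous (m - 1) :=
  (isHomogeneous_clonedDet k m hm).pderiv

theorem aeval_idPoint_clonedMatrix :
    (clonedMatrix k m hm).map (aeval (idPoint k m)) = (1 : Matrix (Fin m) (Fin m) k) := by
  ext i j
  rw [clonedMatrix_eq, Matrix.map_apply, Matrix.of_apply, aeval_X, idPoint_cloneIndex,
    Matrix.one_apply]

theorem clonedDet_ne_zero : clonedDet k m hm ≠ 0 := (irreducible_clonedDet k m hm).ne_zero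

end Polar

/-! ### The inverse of the polar map -/

/-- The minor of `Y` obtained by deleting the rows and columns `a` and `b`. -/
def doubleMinor {A n : Type*} [CommRing A] [Fintype n] [DecidableEq n] (Y : Matrix n n A)
    (a b : n) : A :=
  (Y.updateRow a (Pi.single a 1)).adjugate b b

section DoubleMinor

variable {A n : Type*} [CommRing A] [Fintype n] [DecidableEq n]

theorem doubleMinor_congr {Y Z : Matrix n n A} {a b : n}
    (h : ∀ i, i ≠ a → i ≠ b → Y i = Z i) : doubleMinor Y a b = doubleMinor Z a b := by
  rw [doubleMinor, doubleMinor, Matrix.adjugate_apply, Matrix.adjugate_apply]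
  congr 1
  ext i j
  by_cases hb : i = b
  · subst hb; simp
  · by_cases ha : i = a
    · subst ha; simp [hb]
    · simp [hb, ha, h i ha hb]

theorem doubleMinor_comm (Y : Matrix n n A) (a b : n) : doubleMinor Y a b = doubleMinor Y b a := by
  rcases eq_or_ne a b with rfl | hab
  · rfl
  rw [doubleMinor, doubleMinor, Matrix.adjugate_apply, Matrix.adjugate_apply]
  congr 1
  ext i j
  by_cases hb : i = b
  · subst hb; simp [hab.symm]
  · by_cases ha : i = a
    · subst ha; simp [hab]
    · simp [hb, ha]

theorem doubleMinor_one (a b : n) : doubleMinor (1 : Matrix n n A) a b = 1 := by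
  have h : (1 : Matrix n n A).updateRow a (Pi.single a 1) = 1 := by
    ext i j
    by_cases hi : i = a
    · subst hi; simp [Matrix.one_apply, Pi.single_apply, eq_comm]
    · simp [hi]
  rw [doubleMinor, h, Matrix.adjugate_one, Matrix.one_apply_eq]

theorem map_doubleMinor {B : Type*} [CommRing B] (φ : A →+* B) (Y : Matrix n n A) (a b : n) :
    φ (doubleMinor Y a b) = doubleMinor (Y.map φ) a b := by
  have h : (Y.updateRow a (Pi.single a 1)).map φ
      = (Y.map φ).updateRow a (Pi.single a 1) := by
    ext i j
    by_cases hi : i = a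
    · subst hi
      rw [Matrix.map_apply, Matrix.updateRow_self, Matrix.updateRow_self, Pi.single_apply,
        Pi.single_apply]
      split_ifs <;> simp
    · simp [hi]
  have h2 := RingHom.map_adjugate φ (Y.updateRow a (Pi.single a 1))
  rw [RingHom.mapMatrix_apply, RingHom.mapMatrix_apply, h] at h2
  rw [doubleMinor, doubleMinor, ← h2, Matrix.map_apply]

/-- The dependence of a principal cofactor on another diagonal entry. -/
theorem adjugate_diag_eq {Y Z : Matrix n n A} {a b : n} (hab : a ≠ b) (hZb : Z b b = 0)
    (h : ∀ i j, ¬(i = a ∧ j = a) → ¬(i = b ∧ j = b) → Y i j = Z i j) :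
    Y.adjugate a a = doubleMinor Z a b * Y b b + Z.adjugate a a := by
  rw [Matrix.adjugate_apply, det_eq_mul_adjugate_add _ b b, Matrix.adjugate_apply Z]
  congr 1
  · congr 1
    · refine doubleMinor_congr fun i hia hib => ?_
      funext j
      exact h i j (fun H => hia H.1) (fun H => hib H.1)
    · simp [hab.symm]
  · congr 1
    ext i j
    by_cases hi : i = b
    · subst hi
      rw [Matrix.updateRow_self, Matrix.updateRow_ne hab.symm]
      by_cases hj : j = i
      · subst hj; rw [Function.update_self, Matrix.updateRow_ne hab.symm, hZb]
      · rw [Function.update_of_ne hj, Matrix.updateRow_ne hab.symm]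
        exact h _ _ (fun H => hab H.1.symm) (fun H => hj H.2)
    · rw [Matrix.updateRow_ne hi]
      by_cases hia : i = a
      · subst hia; simp
      · rw [Matrix.updateRow_ne hia, Matrix.updateRow_ne hia]
        exact h _ _ (fun H => hia H.1) (fun H => hi H.1)

end DoubleMinor

section Inverse

variable {A : Type*} [CommRing A] (m : ℕ) (hm : 2 ≤ m)

/-- The cloned matrix with coordinates `v`, with zeros in the two cloned slots. -/
def puncturedMatrix (v : CloneVar m → A) : Matrix (Fin m) (Fin m) A :=
  Matrix.of fun i j => if cloneIndex m hm i j = cloneSource m hm then 0 else v (cloneIndex m hm i j)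

/-- The matrix with off-clone entries proportional to `v` and trace on the cloned slots proportional
to the cloned coordinate, whose cofactors at the two cloned slots agree. -/
def balancedMatrix (v : CloneVar m → A) : Matrix (Fin m) (Fin m) A :=
  Matrix.of fun i j =>
    let Y := puncturedMatrix m hm v
    let a := doubleMinor Y (penult m hm) (ult m hm)
    let b := Y.adjugate (penult m hm) (penult m hm) - Y.adjugate (ult m hm) (ult m hm)
    if i = penult m hm ∧ j = penult m hm then a * v (cloneSource m hm) + b
    else if i = ult m hm ∧ j = ult m hm then a * v (cloneSource m hm) - b
    else 2 * a * v (cloneIndex m hm i j)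

/-- The coordinates of the inverse of the polar map. -/
noncomputable def inversePolar (k : Type*) [Field k] (p : CloneVar m) : MvPolynomial (CloneVar m) k :=
  (balancedMatrix m hm (X : CloneVar m → MvPolynomial (CloneVar m) k)).adjugate p.1.2 p.1.1

variable {m}

theorem map_puncturedMatrix {B : Type*} [CommRing B] (φ : A →+* B) (v : CloneVar m → A) :
    (puncturedMatrix m hm v).map φ = puncturedMatrix m hm (φ ∘ v) := by
  ext i j
  simp only [puncturedMatrix, Matrix.map_apply, Matrix.of_apply]
  split_ifs <;> simp

theorem map_adjugate_apply {B n : Type*} [CommRing B] [Fintype n] [DecidableEq n] (φ : A →+* B)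
    (Y : Matrix n n A) (i j : n) : φ (Y.adjugate i j) = (Y.map φ).adjugate i j := by
  have := congrFun (congrFun (RingHom.map_adjugate φ Y) i) j
  exact this

theorem map_balancedMatrix {B : Type*} [CommRing B] (φ : A →+* B) (v : CloneVar m → A) :
    (balancedMatrix m hm v).map φ = balancedMatrix m hm (φ ∘ v) := by
  ext i j
  simp only [balancedMatrix, Matrix.map_apply, Matrix.of_apply]
  rw [← map_puncturedMatrix, ← map_doubleMinor, ← map_adjugate_apply, ← map_adjugate_apply]
  split_ifs <;> simp [map_ofNat φ 2]

end Inverse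

/-! ### Composition of the polar map with its inverse -/

section Composition

variable (k : Type*) [Field k] (m : ℕ) (hm : 2 ≤ m)

/-- Puncturing alters only rows s and l, which the double minor ignores. -/
theorem doubleMinor_punctured_polar :
    doubleMinor (puncturedMatrix m hm (polarMap (clonedDet k m hm))) (penult m hm) (ult m hm) =
      doubleMinor (clonedMatrix k m hm).adjugateᵀ (penult m hm) (ult m hm) := by
  refine doubleMinor_congr fun i hi hi' => ?_
  funext j
  have h : cloneIndex m hm i j ≠ cloneSource m hm := by
    rw [Ne, cloneIndex_eq_source]
    rintro (H | H)
    exacts [hi H.1, hi' H.1]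
  have h2 := (cloneIndex_eq_iff hm h i j).mp rfl
  rw [puncturedMatrix, Matrix.of_apply, if_neg h, polarMap_clonedDet_of_ne k m hm h, ← h2.1,
    ← h2.2, Matrix.transpose_apply]

theorem doubleMinor_punctured_polar_ne_zero :
    doubleMinor (puncturedMatrix m hm (polarMap (clonedDet k m hm))) (penult m hm) (ult m hm)
      ≠ 0 := by
  intro h
  rw [doubleMinor_punctured_polar] at h
  have h1 := congrArg (aeval (idPoint k m) : MvPolynomial (CloneVar m) k →ₐ[k] k).toRingHom h
  rw [map_doubleMinor, Matrix.transpose_map] at h1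
  have h2 : (clonedMatrix k m hm).adjugate.map
      (aeval (idPoint k m) : MvPolynomial (CloneVar m) k →ₐ[k] k).toRingHom = 1 := by
    have h3 := RingHom.map_adjugate
      (aeval (idPoint k m) : MvPolynomial (CloneVar m) k →ₐ[k] k).toRingHom (clonedMatrix k m hm)
    have h4 : (clonedMatrix k m hm).map
      (aeval (idPoint k m) : MvPolynomial (CloneVar m) k →ₐ[k] k).toRingHom = 1 :=
      aeval_idPoint_clonedMatrix k m hm
    rw [RingHom.mapMatrix_apply, RingHom.mapMatrix_apply, h4, Matrix.adjugate_one] at h3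
    exact h3
  rw [h2, Matrix.transpose_one, doubleMinor_one, map_zero] at h1
  exact one_ne_zero h1

theorem adjugate_adjugate_transpose_clonedMatrix :
    (clonedMatrix k m hm).adjugateᵀ.adjugate =
      (clonedDet k m hm ^ (m - 2)) • (clonedMatrix k m hm)ᵀ := by
  rw [← Matrix.adjugate_transpose, Matrix.adjugate_adjugate _ (by simp; omega),
    Matrix.transpose_smul, Fintype.card_fin, clonedDet]

/-- The cofactors of N at the cloned slots agree, which gives Δ(N_ss - N_ll) = b in the notation of
the balanced matrix. Together with the known sum N_ss + N_ll this determines 2ΔN_ss and 2ΔN_ll. -/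
theorem balancedMatrix_polar :
    balancedMatrix m hm (polarMap (clonedDet k m hm)) =
      (2 * doubleMinor (puncturedMatrix m hm (polarMap (clonedDet k m hm))) (penult m hm)
        (ult m hm)) • (clonedMatrix k m hm).adjugateᵀ := by
  set Y := puncturedMatrix m hm (polarMap (clonedDet k m hm)) with hY
  set N := (clonedMatrix k m hm).adjugateᵀ with hN
  set s := penult m hm with hs
  set l := ult m hm with hl
  have hsl : s ≠ l := penult_ne_ult m hm
  have hYN : ∀ i j, ¬(i = s ∧ j = s) → ¬(i = l ∧ j = l) →
      polarMap (clonedDet k m hm) (cloneIndex m hm i j) = N i j ∧ N i j = Y i j := by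
    intro i j h1 h2
    have h : cloneIndex m hm i j ≠ cloneSource m hm := by
      rw [Ne, cloneIndex_eq_source]
      tauto
    have h3 := (cloneIndex_eq_iff hm h i j).mp rfl
    have h4 : polarMap (clonedDet k m hm) (cloneIndex m hm i j) = N i j := by
      rw [polarMap_clonedDet_of_ne k m hm h, ← h3.1, ← h3.2, hN, Matrix.transpose_apply]
    exact ⟨h4, by rw [hY, puncturedMatrix, Matrix.of_apply, if_neg h, h4]⟩
  have hYs : Y s s = 0 := by
    rw [hY, puncturedMatrix, Matrix.of_apply, if_pos (cloneIndex_penult m hm)]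
  have hYl : Y l l = 0 := by
    rw [hY, puncturedMatrix, Matrix.of_apply, if_pos (cloneIndex_ult m hm)]
  have e1 := adjugate_diag_eq hsl hYl fun i j h1 h2 => (hYN i j h1 h2).2
  have e2 := adjugate_diag_eq hsl.symm hYs fun i j h1 h2 => (hYN i j h2 h1).2
  rw [doubleMinor_comm] at e2
  -- This is where cloning enters: adj N is proportional to Mᵀ, whose two cloned entries coincide.
  have e3 : N.adjugate s s = N.adjugate l l := by
    rw [hN, adjugate_adjugate_transpose_clonedMatrix, clonedMatrix_eq]
    simp only [Matrix.smul_apply, Matrix.transpose_apply, Matrix.of_apply]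
    rw [cloneIndex_penult, cloneIndex_ult]
  have e4 : polarMap (clonedDet k m hm) (cloneSource m hm) = N s s + N l l :=
    polarMap_clonedDet_source k m hm
  rw [e1, e2] at e3
  ext1 i j
  simp only [balancedMatrix, Matrix.of_apply, Matrix.smul_apply, smul_eq_mul]
  rw [← hY, ← hs, ← hl, e4]
  split_ifs with h1 h2
  · rw [h1.1, h1.2]
    linear_combination e3
  · rw [h2.1, h2.2]
    linear_combination -e3
  · rw [(hYN i j h1 h2).1]

theorem aeval_polar_inversePolar (p : CloneVar m) :
    aeval (polarMap (clonedDet k m hm)) (inversePolar m hm k p) =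
      ((2 * doubleMinor (puncturedMatrix m hm (polarMap (clonedDet k m hm))) (penult m hm)
        (ult m hm)) ^ (m - 1) * clonedDet k m hm ^ (m - 2)) * X p := by
  have h := map_adjugate_apply
    (aeval (polarMap (clonedDet k m hm)) : _ →ₐ[k] MvPolynomial (CloneVar m) k).toRingHom
    (balancedMatrix m hm (X : CloneVar m → MvPolynomial (CloneVar m) k)) p.1.2 p.1.1
  have h1 : (aeval (polarMap (clonedDet k m hm)) : _ →ₐ[k] MvPolynomial (CloneVar m) k).toRingHom ∘
      (X : CloneVar m → MvPolynomial (CloneVar m) k) = polarMap (clonedDet k m hm) := by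
    funext i
    exact aeval_X _ _
  rw [map_balancedMatrix, h1, balancedMatrix_polar, Matrix.adjugate_smul,
    adjugate_adjugate_transpose_clonedMatrix, Fintype.card_fin] at h
  refine h.trans ?_
  rw [clonedMatrix_eq]
  simp only [Matrix.smul_apply, Matrix.transpose_apply, Matrix.of_apply, smul_eq_mul,
    cloneIndex_val]
  ring

end Composition

/-! ### Degrees -/

section Degrees

variable (k : Type*) [Field k] (m : ℕ) (hm : 2 ≤ m)

theorem sum_ite_eq_zero_else (a : Fin m) (c : ℕ) :
    ∑ i : Fin m, (if i = a then 0 else c) = (m - 1) * c := by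
  rw [Finset.sum_ite, Finset.sum_const_zero, zero_add, Finset.sum_const, smul_eq_mul,
    Finset.filter_ne', Finset.card_erase_of_mem (Finset.mem_univ _), Finset.card_univ,
    Fintype.card_fin]

theorem isHomogeneous_adjugate {d : ℕ} {M : Matrix (Fin m) (Fin m) (MvPolynomial (CloneVar m) k)}
    (h : ∀ i j, (M i j).IsHomogeneous d) (i j : Fin m) :
    (M.adjugate i j).IsHomogeneous ((m - 1) * d) := by
  rw [Matrix.adjugate_apply, ← sum_ite_eq_zero_else m j d]
  refine isHomogeneous_det fun a b => ?_
  split_ifs with ha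
  · subst ha
    rw [Matrix.updateRow_self]
    exact isHomogeneous_single _ _
  · rw [Matrix.updateRow_ne ha]
    exact h a b

theorem isHomogeneous_puncturedMatrix (i j : Fin m) :
    (puncturedMatrix m hm (X : CloneVar m → MvPolynomial (CloneVar m) k) i j).IsHomogeneous 1 := by
  rw [puncturedMatrix, Matrix.of_apply]
  split_ifs
  · exact isHomogeneous_zero _ _ _
  · exact isHomogeneous_X _ _

theorem isHomogeneous_doubleMinor :
    (doubleMinor (puncturedMatrix m hm (X : CloneVar m → MvPolynomial (CloneVar m) k))
      (penult m hm) (ult m hm)).IsHomogeneous (m - 2) := by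
  have hd : ∑ i : Fin m, (if i = ult m hm then 0 else if i = penult m hm then 0 else 1) = m - 2 := by
    have h2 : ∑ i : Fin m, (if i = penult m hm then 0 else 1) = m - 1 := by
      rw [sum_ite_eq_zero_else, mul_one]
    rw [← Finset.add_sum_erase _ _ (Finset.mem_univ (ult m hm)),
      if_neg (penult_ne_ult m hm).symm] at h2
    rw [← Finset.add_sum_erase _ _ (Finset.mem_univ (ult m hm)), if_pos rfl,
      Finset.sum_congr rfl fun i hi => if_neg (Finset.ne_of_mem_erase hi)]
    omega
  rw [doubleMinor, Matrix.adjugate_apply, ← hd]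
  refine isHomogeneous_det fun a b => ?_
  split_ifs with ha ha'
  · subst ha
    rw [Matrix.updateRow_self]
    exact isHomogeneous_single _ _
  · subst ha'
    rw [Matrix.updateRow_ne ha, Matrix.updateRow_self]
    exact isHomogeneous_single _ _
  · rw [Matrix.updateRow_ne ha, Matrix.updateRow_ne ha']
    exact isHomogeneous_puncturedMatrix k m hm a b

theorem isHomogeneous_balancedMatrix (i j : Fin m) :
    (balancedMatrix m hm (X : CloneVar m → MvPolynomial (CloneVar m) k) i j).IsHomogeneous
      (m - 1) := by
  have hA : ∀ p, (doubleMinor (puncturedMatrix m hm (X : CloneVar m → MvPolynomial (CloneVar m) k))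
      (penult m hm) (ult m hm) * X p).IsHomogeneous (m - 1) := fun p => by
    have := (isHomogeneous_doubleMinor k m hm).mul (isHomogeneous_X k p)
    rwa [show m - 2 + 1 = m - 1 by omega] at this
  have hB := isHomogeneous_adjugate k m (isHomogeneous_puncturedMatrix k m hm)
  simp only [mul_one] at hB
  simp only [balancedMatrix, Matrix.of_apply]
  split_ifs
  · exact (hA _).add ((hB _ _).sub (hB _ _))
  · exact (hA _).sub ((hB _ _).sub (hB _ _))
  · rw [mul_assoc, ← map_ofNat (C : k →+* MvPolynomial (CloneVar m) k) 2]
    exact (hA _).C_mul _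

theorem isHomogeneous_inversePolar (p : CloneVar m) :
    (inversePolar m hm k p).IsHomogeneous ((m - 1) * (m - 1)) :=
  isHomogeneous_adjugate k m (isHomogeneous_balancedMatrix k m hm) _ _

end Degrees

/-! ### Nonvanishing Hessian and homaloidality -/

section Homaloidal

variable (k : Type*) [Field k] [CharZero k] (m : ℕ) (hm : 2 ≤ m)

/-- The common factor of the composition of the polar map with its inverse. -/
theorem exists_factor : ∃ (h : MvPolynomial (CloneVar m) k) (e : ℕ), h ≠ 0 ∧ h.IsHomogeneous e ∧
    ∀ p, aeval (polarMap (clonedDet k m hm)) (inversePolar m hm k p) = h * X p := by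
  have hA : (doubleMinor (puncturedMatrix m hm (polarMap (clonedDet k m hm))) (penult m hm)
      (ult m hm)).IsHomogeneous ((m - 1) * (m - 2)) := by
    have h1 := (isHomogeneous_doubleMinor k m hm).aeval _ (isHomogeneous_polarMap k m hm)
    have h2 := map_doubleMinor
      (aeval (polarMap (clonedDet k m hm)) : _ →ₐ[k] MvPolynomial (CloneVar m) k).toRingHom
      (puncturedMatrix m hm (X : CloneVar m → MvPolynomial (CloneVar m) k)) (penult m hm)
      (ult m hm)
    have h3 : (aeval (polarMap (clonedDet k m hm)) :
        _ →ₐ[k] MvPolynomial (CloneVar m) k).toRingHom ∘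
        (X : CloneVar m → MvPolynomial (CloneVar m) k) = polarMap (clonedDet k m hm) := by
      funext i
      exact aeval_X _ _
    rw [map_puncturedMatrix, h3] at h2
    rw [← h2]
    exact h1
  -- The two summands are the degrees of (2Δ)^(m-1) and f^(m-2).
  refine ⟨_, (m - 1) * (m - 2) * (m - 1) + m * (m - 2), ?_, ?_, aeval_polar_inversePolar k m hm⟩
  · exact mul_ne_zero (pow_ne_zero _ (mul_ne_zero two_ne_zero
      (doubleMinor_punctured_polar_ne_zero k m hm))) (pow_ne_zero _ (clonedDet_ne_zero k m hm))
  · refine IsHomogeneous.mul (IsHomogeneous.pow ?_ _) ((isHomogeneous_clonedDet k m hm).pow _)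
    rw [← map_ofNat (C : k →+* MvPolynomial (CloneVar m) k) 2]
    exact hA.C_mul _

theorem hessian_clonedDet_ne_zero : (hessian (clonedDet k m hm)).det ≠ 0 := by
  obtain ⟨h, e, h0, he, hG⟩ := exists_factor k m hm
  exact jacobian_det_ne_zero h0 he hG

theorem aeval_polarMap_eq_zero (P : MvPolynomial (CloneVar m) k)
    (hP : aeval (polarMap (clonedDet k m hm)) P = 0) : P = 0 :=
  aeval_injective_of_jacobian (hessian_clonedDet_ne_zero k m hm) P hP

theorem polarMap_ne_zero (p : CloneVar m) : polarMap (clonedDet k m hm) p ≠ 0 := by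
  intro h
  have := aeval_polarMap_eq_zero k m hm (X p) (by rw [aeval_X, h])
  exact X_ne_zero p this

theorem isHomaloidal_clonedDet : IsHomaloidal (clonedDet k m hm) := by
  obtain ⟨h, e, h0, he, hG⟩ := exists_factor k m hm
  have hne : ∀ p, aeval (polarMap (clonedDet k m hm)) (inversePolar m hm k p) ≠ 0 := fun p => by
    rw [hG]
    exact mul_ne_zero h0 (X_ne_zero p)
  refine ⟨⟨m, hm, isHomogeneous_clonedDet k m hm⟩, ⟨⟨m - 1, by omega, isHomogeneous_polarMap k m hm,
    cloneSource m hm, polarMap_ne_zero k m hm _⟩, inversePolar m hm k,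
    ⟨(m - 1) * (m - 1), ?_, isHomogeneous_inversePolar k m hm, cloneSource m hm, fun H => ?_⟩,
    ⟨cloneSource m hm, hne _⟩, fun i j => ?_⟩, ?_⟩
  · have : 1 ≤ m - 1 := by omega
    exact Nat.mul_le_mul this this
  · exact hne (cloneSource m hm) (by rw [H, map_zero])
  · rw [hG, hG]
    ring
  · rw [imageIdeal, eq_bot_iff]
    intro P hP
    exact aeval_polarMap_eq_zero k m hm P hP

end Homaloidal

/-! ### Minimal systems of forms -/

section Forms

variable {k σ : Type*} [Field k]

theorem homogeneousComponent_mul_of_lt {s n : ℕ} (hn : n < s) {g : MvPolynomial σ k}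
    (hg : g.IsHomogeneous s) (p : MvPolynomial σ k) : homogeneousComponent n (p * g) = 0 := by
  conv_lhs => rw [← sum_homogeneousComponent p]
  rw [Finset.sum_mul, map_sum]
  refine Finset.sum_eq_zero fun i _ => ?_
  rw [homogeneousComponent_of_mem ((homogeneousComponent_isHomogeneous i p).mul hg),
    if_neg (by omega)]

theorem homogeneousComponent_mul_self {s : ℕ} {g : MvPolynomial σ k}
    (hg : g.IsHomogeneous s) (p : MvPolynomial σ k) :
    homogeneousComponent s (p * g) = coeff 0 p • g := by
  conv_lhs => rw [← sum_homogeneousComponent p]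
  rw [Finset.sum_mul, map_sum, Finset.sum_eq_single 0]
  · rw [homogeneousComponent_of_mem ((homogeneousComponent_isHomogeneous 0 p).mul hg),
      if_pos (by omega), homogeneousComponent_zero, smul_eq_C_mul]
  · intro i _ hi
    rw [homogeneousComponent_of_mem ((homogeneousComponent_isHomogeneous i p).mul hg),
      if_neg (by omega)]
  · simp

theorem eq_zero_of_mem_span_of_lt {S : Set (MvPolynomial σ k)} {s n : ℕ} (hn : n < s)
    (hS : ∀ g ∈ S, g.IsHomogeneous s) {a : MvPolynomial σ k} (ha : a ∈ Ideal.span S)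
    (hhom : a.IsHomogeneous n) : a = 0 := by
  have h : ∀ p, homogeneousComponent n (p * a) = 0 := by
    clear hhom
    induction ha using Submodule.span_induction with
    | mem g hg => exact fun p => homogeneousComponent_mul_of_lt hn (hS g hg) p
    | zero => simp
    | add x y _ _ hx hy => exact fun p => by rw [mul_add, map_add, hx, hy, add_zero]
    | smul r x _ hx => exact fun p => by rw [smul_eq_mul, ← mul_assoc, hx]
  have h1 := h 1
  rwa [one_mul, homogeneousComponent_eq_self hhom] at h1

/-- In degree s only the constant terms of the coefficients contribute. The induction carries an
arbitrary multiplier p so that it passes through scalar multiplication. -/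
theorem mem_span_of_isHomogeneous {S : Set (MvPolynomial σ k)} {s : ℕ}
    (hS : ∀ g ∈ S, g.IsHomogeneous s) {a : MvPolynomial σ k} (ha : a ∈ Ideal.span S)
    (hhom : a.IsHomogeneous s) : a ∈ Submodule.span k S := by
  have h : ∀ p, homogeneousComponent s (p * a) ∈ Submodule.span k S := by
    clear hhom
    induction ha using Submodule.span_induction with
    | mem g hg =>
      intro p
      rw [homogeneousComponent_mul_self (hS g hg)]
      exact Submodule.smul_mem _ _ (Submodule.subset_span hg)
    | zero => simp
    | add x y _ _ hx hy => exact fun p => by rw [mul_add, map_add]; exact add_mem (hx p) (hy p)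
    | smul r x _ hx => exact fun p => by rw [smul_eq_mul, ← mul_assoc]; exact hx _
  have h1 := h 1
  rwa [one_mul, homogeneousComponent_eq_self hhom] at h1

theorem span_le_ideal_span (S : Set (MvPolynomial σ k)) {a : MvPolynomial σ k}
    (ha : a ∈ Submodule.span k S) : a ∈ Ideal.span S :=
  Submodule.span_le_restrictScalars k (MvPolynomial σ k) S ha

variable {ι κ : Type*} {I : Ideal (MvPolynomial σ k)}

theorem IsMinimalFormSystem.linearIndependent {s : ℕ} {g : ι → MvPolynomial σ k}
    (hg : IsMinimalFormSystem I s g) : LinearIndependent k g := by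
  rw [linearIndependent_iff_notMem_span]
  intro i hi
  refine hg.irredundant i (span_le_ideal_span _ ?_)
  rwa [← Set.compl_eq_univ_sdiff] at hi

theorem isMinimalFormSystem_of_linearIndependent {s : ℕ} {g : ι → MvPolynomial σ k}
    (hg : LinearIndependent k g) (hs : ∀ i, (g i).IsHomogeneous s) :
    IsMinimalFormSystem (Ideal.span (Set.range g)) s g := by
  refine ⟨hs, rfl, fun i hi => ?_⟩
  refine linearIndependent_iff_notMem_span.mp hg i ?_
  have h := mem_span_of_isHomogeneous (by rintro _ ⟨j, _, rfl⟩; exact hs j) hi (hs i)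
  rwa [← Set.compl_eq_univ_sdiff]

theorem IsMinimalFormSystem.mem {s : ℕ} {g : ι → MvPolynomial σ k}
    (hg : IsMinimalFormSystem I s g) (i : ι) : g i ∈ I := by
  rw [← hg.span_eq]
  exact Ideal.subset_span ⟨i, rfl⟩

theorem IsMinimalFormSystem.degree_le {s s' : ℕ} {g : ι → MvPolynomial σ k}
    {g' : κ → MvPolynomial σ k} (hg : IsMinimalFormSystem I s g)
    (hg' : IsMinimalFormSystem I s' g') [Nonempty κ] : s ≤ s' := by
  obtain ⟨j⟩ := ‹Nonempty κ›
  by_contra! hlt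
  refine hg'.linearIndependent.ne_zero j (eq_zero_of_mem_span_of_lt (S := Set.range g) hlt ?_ ?_
    (hg'.isHomogeneous j))
  · rintro _ ⟨i, rfl⟩
    exact hg.isHomogeneous i
  · rw [hg.span_eq]
    exact hg'.mem j

theorem IsMinimalFormSystem.nonempty_of_nonempty {s s' : ℕ} {g : ι → MvPolynomial σ k}
    {g' : κ → MvPolynomial σ k} (hg : IsMinimalFormSystem I s g)
    (hg' : IsMinimalFormSystem I s' g') [Nonempty κ] : Nonempty ι := by
  obtain ⟨j⟩ := ‹Nonempty κ›
  by_contra! hι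
  have h := hg'.mem j
  rw [← hg.span_eq, Set.range_eq_empty, Ideal.span_empty] at h
  exact hg'.linearIndependent.ne_zero j h

/-- The members of one minimal system are linear combinations of those of any other. -/
theorem IsMinimalFormSystem.exists_matrix [Fintype ι] {s s' : ℕ} {g : ι → MvPolynomial σ k}
    {g' : κ → MvPolynomial σ k} (hg : IsMinimalFormSystem I s g)
    (hg' : IsMinimalFormSystem I s' g') (hs : s = s') :
    ∃ T : Matrix κ ι k, ∀ j, ∑ i, T j i • g i = g' j := by
  subst hs
  have h : ∀ j, ∃ c : ι → k, ∑ i, c i • g i = g' j := by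
    intro j
    rw [← Submodule.mem_span_range_iff_exists_fun]
    refine mem_span_of_isHomogeneous ?_ ?_ (hg'.isHomogeneous j)
    · rintro _ ⟨i, rfl⟩
      exact hg.isHomogeneous i
    · rw [hg.span_eq]
      exact hg'.mem j
  choose T hT using h
  exact ⟨T, hT⟩

/-- Two minimal systems differ by scalar matrices with T·T' = 1. Multiplication by T is therefore
injective, and being scalar it carries linear syzygies to linear syzygies. By symmetry the linear
rank is independent of the system. -/
theorem finrank_linearSyzygies_le [Finite σ] [Fintype ι] [Fintype κ] {s s' : ℕ}
    {g : ι → MvPolynomial σ k} {g' : κ → MvPolynomial σ k} (hg : IsMinimalFormSystem I s g)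
    (hg' : IsMinimalFormSystem I s' g') :
    Module.finrank (MvPolynomial σ k) (linearSyzygies g') ≤
      Module.finrank (MvPolynomial σ k) (linearSyzygies g) := by
  classical
  rcases isEmpty_or_nonempty κ with hκ | hκ
  · rw [Module.finrank_zero_of_subsingleton]
    exact Nat.zero_le _
  have hι := hg.nonempty_of_nonempty hg'
  have hs : s = s' := le_antisymm (hg.degree_le hg') (hg'.degree_le hg)
  obtain ⟨T, hT⟩ := hg.exists_matrix hg' hs
  obtain ⟨T', hT'⟩ := hg'.exists_matrix hg hs.symm
  have hTT : T * T' = 1 := by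
    ext j l
    have hinj := linearIndependent_iff_injective_fintypeLinearCombination.mp hg'.linearIndependent
    have : (T * T') j = (1 : Matrix κ κ k) j := by
      apply hinj
      rw [Fintype.linearCombination_apply, Fintype.linearCombination_apply]
      have h1 : ∑ l, (1 : Matrix κ κ k) j l • g' l = g' j := by
        simp [Matrix.one_apply]
      rw [h1, ← hT j]
      simp_rw [Matrix.mul_apply, Finset.sum_smul, mul_smul]
      rw [Finset.sum_comm]
      refine Finset.sum_congr rfl fun i _ => ?_
      rw [← Finset.smul_sum, hT']
    rw [this]
  set N : Matrix κ ι (MvPolynomial σ k) := T.map C with hN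
  set N' : Matrix ι κ (MvPolynomial σ k) := T'.map C with hN'
  have hNN : N * N' = 1 := by
    rw [hN, hN', ← Matrix.map_mul, hTT, Matrix.map_one _ (map_zero C) (map_one C)]
  let Φ := Matrix.vecMulLinear N
  have hΦ : Function.Injective Φ := by
    intro c d hcd
    have h1 : c ᵥ* N = d ᵥ* N := hcd
    have h2 := congrArg (fun x => x ᵥ* N') h1
    simpa only [Matrix.vecMul_vecMul, hNN, Matrix.vecMul_one] using h2
  have hmap : ∀ c ∈ linearSyzygies g', Φ c ∈ linearSyzygies g := by
    intro c hc
    have hle : linearSyzygies g' ≤ (linearSyzygies g).comap Φ := by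
      refine Submodule.span_le.mpr ?_
      rintro c ⟨hc, hlin⟩
      refine Submodule.subset_span ⟨?_, fun i => ?_⟩
      · have hc' : ∑ j, c j • g' j = 0 := hc
        change ∑ i, (∑ j, c j * C (T j i)) • g i = 0
        rw [← hc']
        simp_rw [Finset.sum_smul]
        rw [Finset.sum_comm]
        refine Finset.sum_congr rfl fun j _ => ?_
        rw [← hT j, Finset.smul_sum]
        refine Finset.sum_congr rfl fun i _ => ?_
        rw [smul_eq_C_mul, smul_eq_mul, smul_eq_mul, mul_assoc]
      · change (∑ j, c j * C (T j i)).IsHomogeneous 1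
        refine IsHomogeneous.sum _ _ _ fun j _ => ?_
        rw [mul_comm]
        exact (hlin j).C_mul _
    exact hle hc
  refine LinearMap.finrank_le_finrank_of_injective (f := Φ.restrict hmap) ?_
  intro c d hcd
  exact Subtype.ext (hΦ (congrArg Subtype.val hcd))

/-- Rank–nullity: the image is a nonzero ideal of a domain, hence of rank one. -/
theorem finrank_syzygies [Finite σ] [Fintype ι] {g : ι → MvPolynomial σ k}
    (hg : ∃ i, g i ≠ 0) :
    Module.finrank (MvPolynomial σ k) (syzygies g) + 1 = Fintype.card ι := by
  classical
  obtain ⟨i, hi⟩ := hg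
  have h := (LinearMap.ker (Fintype.linearCombination (MvPolynomial σ k) g)).finrank_quotient_add_finrank
  rw [(LinearMap.quotKerEquivRange _).finrank_eq] at h
  have h1 : Module.finrank (MvPolynomial σ k)
      (LinearMap.range (Fintype.linearCombination (MvPolynomial σ k) g)) = 1 := by
    apply le_antisymm
    · refine (Submodule.finrank_le _).trans_eq ?_
      exact Module.finrank_self _
    · have : Nontrivial (LinearMap.range (Fintype.linearCombination (MvPolynomial σ k) g)) := by
        refine ⟨⟨⟨g i, Pi.single i 1, by simp⟩, 0, fun H => hi (congrArg Subtype.val H)⟩⟩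
      exact Module.finrank_pos
  rw [h1, Module.finrank_fintype_fun_eq_card] at h
  rw [← h, syzygies, add_comm]

theorem linearSyzygies_le_syzygies [Fintype ι] (g : ι → MvPolynomial σ k) :
    linearSyzygies g ≤ syzygies g :=
  Submodule.span_le.mpr fun _ hc => hc.1

theorem hasMaximalLinearRank_of_finrank [Finite σ] [Fintype ι] {s : ℕ} {g : ι → MvPolynomial σ k}
    (hg : IsMinimalFormSystem I s g) {n : ℕ} (hn : Fintype.card ι = n + 1)
    (hrank : Module.finrank (MvPolynomial σ k) (linearSyzygies g) = n) :
    HasLinearRank I n ∧ HasMaximalLinearRank I := by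
  let e : Fin (n + 1) ≃ ι := (Fintype.equivFinOfCardEq hn).symm
  have hge : IsMinimalFormSystem I s (g ∘ e) := by
    have hr : Set.range (g ∘ e) = Set.range g := e.surjective.range_comp g
    have := isMinimalFormSystem_of_linearIndependent (hg.linearIndependent.comp e e.injective)
      fun i => hg.isHomogeneous (e i)
    rwa [hr, hg.span_eq] at this
  have hlin : HasLinearRank I n := by
    refine ⟨⟨_, s, _, hge⟩, fun n' s' g' hg' => ?_⟩
    rw [← hrank]
    exact le_antisymm (finrank_linearSyzygies_le hg hg') (finrank_linearSyzygies_le hg' hg)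
  refine ⟨hlin, n, s, _, hge, ?_, hlin⟩
  have := finrank_syzygies (g := g ∘ e) ⟨0, hge.linearIndependent.ne_zero 0⟩
  rw [Fintype.card_fin] at this
  omega

end Forms

/-! ### Linear syzygies of the partial derivatives -/

section Syzygies

variable (k : Type*) [Field k] (m : ℕ) (hm : 2 ≤ m)

theorem clonedMatrix_penult_eq_ult :
    clonedMatrix k m hm (penult m hm) (penult m hm) = clonedMatrix k m hm (ult m hm) (ult m hm) := by
  rw [clonedMatrix_eq, Matrix.of_apply, Matrix.of_apply, cloneIndex_penult, cloneIndex_ult]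

theorem exists_linear_syzygy (P Q : Matrix (Fin m) (Fin m) k) (htr : P.trace + Q.trace = 0)
    (hPQ : (P.map C * clonedMatrix k m hm + clonedMatrix k m hm * Q.map C :
        Matrix _ _ (MvPolynomial (CloneVar m) k))
        (penult m hm) (penult m hm) =
      (P.map C * clonedMatrix k m hm + clonedMatrix k m hm * Q.map C :
        Matrix _ _ (MvPolynomial (CloneVar m) k)) (ult m hm) (ult m hm)) :
    ∃ c ∈ syzygies (polarMap (clonedDet k m hm)), (∀ p, (c p).IsHomogeneous 1) ∧
      ∀ p, aeval (idPoint k m) (c p) = (P + Q) p.1.1 p.1.2 := by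
  set M := clonedMatrix k m hm with hM
  set Z := P.map C * M + M * Q.map C with hZ
  -- Equality of Z in the two cloned slots lets it be read as a function of the variables.
  have hc : ∀ i j, Z (cloneIndex m hm i j).1.1 (cloneIndex m hm i j).1.2 = Z i j := by
    intro i j
    by_cases h : cloneIndex m hm i j = cloneSource m hm
    · have h2 : Z (penult m hm) (penult m hm) = Z i j := by
        rcases (cloneIndex_eq_source hm i j).mp h with ⟨rfl, rfl⟩ | ⟨rfl, rfl⟩
        · rfl
        · exact hPQ
      rw [h]
      exact h2
    · obtain ⟨h1, h2⟩ := (cloneIndex_eq_iff hm h i j).mp rfl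
      rw [← h1, ← h2]
  refine ⟨fun p => Z p.1.1 p.1.2, ?_, fun p => ?_, fun p => ?_⟩
  · have h1 := sum_mul_polarMap_clonedDet k m hm fun p => Z p.1.1 p.1.2
    simp_rw [hc] at h1
    have h2 : ∑ i, ∑ j, Z i j * M.adjugate j i = (Z * M.adjugate).trace := by
      simp [Matrix.trace, Matrix.mul_apply]
    have h3 : (Z * M.adjugate).trace = 0 := by
      have hp : (P.map C).trace + (Q.map C).trace = (0 : MvPolynomial (CloneVar m) k) := by
        have := congrArg (C : k →+* MvPolynomial (CloneVar m) k) htr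
        simpa [Matrix.trace] using this
      rw [hZ, Matrix.add_mul, Matrix.trace_add, Matrix.mul_assoc, Matrix.mul_adjugate,
        Matrix.trace_mul_cycle, Matrix.adjugate_mul, Matrix.mul_smul, Matrix.smul_mul,
        Matrix.mul_one, Matrix.one_mul, Matrix.trace_smul, Matrix.trace_smul, ← smul_add, hp,
        smul_zero]
    rw [h2, h3] at h1
    exact h1
  · have hX : ∀ i j, (M i j).IsHomogeneous 1 := fun i j => by
      rw [hM, clonedMatrix_eq]
      exact isHomogeneous_X _ _
    change (Z p.1.1 p.1.2).IsHomogeneous 1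
    rw [hZ, Matrix.add_apply, Matrix.mul_apply, Matrix.mul_apply]
    refine (IsHomogeneous.sum _ _ _ fun i _ => ?_).add (IsHomogeneous.sum _ _ _ fun i _ => ?_)
    · exact (hX _ _).C_mul _
    · rw [mul_comm]
      exact (hX _ _).C_mul _
  · have h1 : Z.map (aeval (idPoint k m) : _ →ₐ[k] k) = P + Q := by
      have hP : ∀ R : Matrix (Fin m) (Fin m) k,
          (R.map C).map (aeval (idPoint k m) : _ →ₐ[k] k) = R := by
        intro R
        ext i j
        simp
      rw [hZ, Matrix.map_add _ (map_add _), Matrix.map_mul, Matrix.map_mul, hP, hP,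
        hM, aeval_idPoint_clonedMatrix, Matrix.mul_one, Matrix.one_mul]
    rw [← h1]
    rfl

/-- At the identity these syzygies form a diagonal system away from the cloned coordinate, which
gives their independence. The choice of P and Q depends on how p meets the indices s and l. -/
theorem exists_linear_syzygy_dual [CharZero k] (p : CloneVar m) (hp : p ≠ cloneSource m hm) :
    ∃ c ∈ syzygies (polarMap (clonedDet k m hm)), (∀ q, (c q).IsHomogeneous 1) ∧
      ∃ t : k, t ≠ 0 ∧ ∀ q, q ≠ cloneSource m hm →
        aeval (idPoint k m) (c q) = if q = p then t else 0 := by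
  obtain ⟨⟨i, j⟩, hij⟩ := p
  set s := penult m hm with hs
  set l := ult m hm with hl
  have hsl : s ≠ l := penult_ne_ult m hm
  have hij' : ¬(i = l ∧ j = l) := by
    rintro ⟨rfl, rfl⟩
    exact hij (by simp only [hl, ult]; omega)
  have hijs : ¬(i = s ∧ j = s) := by
    rintro ⟨rfl, rfl⟩
    exact hp rfl
  have hext : ∀ q : CloneVar m, (q = ⟨(i, j), hij⟩) ↔ (q.1.1 = i ∧ q.1.2 = j) := by
    intro q
    rw [Subtype.ext_iff, Prod.ext_iff]
  by_cases hd : i = j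
  · subst hd
    have his : i ≠ s := fun h => hijs ⟨h, h⟩
    have hil : i ≠ l := fun h => hij' ⟨h, h⟩
    obtain ⟨c, hc, hlin, hev⟩ := exists_linear_syzygy k m hm
      -- The entries -1 at both s and l cancel the trace while keeping the cloned slots equal.
      (Matrix.diagonal (Pi.single i 2 - Pi.single s 1 - Pi.single l 1)) 0 (by
        rw [Matrix.trace_diagonal, Matrix.trace_zero]
        simp [Finset.sum_sub_distrib]
        norm_num) (by
        rw [Matrix.diagonal_map (map_zero C), Matrix.map_zero _ (map_zero C), Matrix.mul_zero,
          add_zero, Matrix.diagonal_mul, Matrix.diagonal_mul, clonedMatrix_penult_eq_ult,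
          ← hs, ← hl]
        simp [his.symm, hil.symm, hsl, hsl.symm])
    refine ⟨c, hc, hlin, 2, two_ne_zero, fun q hq => ?_⟩
    rw [hev, add_zero, Matrix.diagonal_apply, if_congr (hext q) rfl rfl]
    by_cases hqq : q.1.1 = q.1.2
    · have h1 : q.1.1 ≠ s := fun h => hq ((cloneIndex_val hm q).symm.trans
        ((cloneIndex_eq_source hm _ _).mpr (Or.inl ⟨h, hqq ▸ h⟩)))
      have h2 : q.1.1 ≠ l := fun h => hq ((cloneIndex_val hm q).symm.trans
        ((cloneIndex_eq_source hm _ _).mpr (Or.inr ⟨h, hqq ▸ h⟩)))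
      rw [if_pos hqq, ← hqq]
      simp [Pi.single_apply, h1, h2]
    · rw [if_neg hqq, if_neg]
      rintro ⟨h1, h2⟩
      exact hqq (h1.trans h2.symm)
  have hmap : (Matrix.single i j (1 : k)).map C =
      Matrix.single i j (1 : MvPolynomial (CloneVar m) k) := by
    rw [Matrix.map_single _ _ _ C, map_one]
  have hsing : ∀ q : CloneVar m, Matrix.single i j (1 : k) q.1.1 q.1.2 =
      if q = ⟨(i, j), hij⟩ then 1 else 0 := by
    intro q
    rw [Matrix.single_apply, if_congr (hext q) rfl rfl]
    exact if_congr (by rw [eq_comm, @eq_comm _ j]) rfl rfl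
  have htr : (Matrix.single i j (1 : k)).trace = 0 := Matrix.trace_single_eq_of_ne _ _ _ hd
  by_cases hi : i = s ∨ i = l
  · by_cases hj : j = s ∨ j = l
    · obtain ⟨c, hc, hlin, hev⟩ := exists_linear_syzygy k m hm
        -- Using the unit matrix on both sides puts the same entry M_ji into both cloned slots; one
        -- side alone would fill only one.
        (Matrix.single i j 1) (Matrix.single i j 1) (by rw [htr, add_zero]) (by
          rw [hmap, Matrix.add_apply, Matrix.add_apply, ← hs, ← hl]
          rcases hi with rfl | rfl <;> rcases hj with rfl | rfl
          · exact absurd rfl hd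
          · simp [hsl, hsl.symm]
          · simp [hsl, hsl.symm]
          · exact absurd rfl hd)
      refine ⟨c, hc, hlin, 2, two_ne_zero, fun q _ => ?_⟩
      rw [hev, Matrix.add_apply, hsing]
      split_ifs <;> norm_num
    · push Not at hj
      obtain ⟨c, hc, hlin, hev⟩ := exists_linear_syzygy k m hm
        0 (Matrix.single i j 1) (by rw [htr, Matrix.trace_zero, add_zero]) (by
          rw [hmap, Matrix.map_zero _ (map_zero C), Matrix.zero_mul, zero_add, ← hs, ← hl]
          simp [hj.1.symm, hj.2.symm])
      refine ⟨c, hc, hlin, 1, one_ne_zero, fun q _ => ?_⟩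
      rw [hev, zero_add, hsing]
  · push Not at hi
    obtain ⟨c, hc, hlin, hev⟩ := exists_linear_syzygy k m hm
      (Matrix.single i j 1) 0 (by rw [htr, Matrix.trace_zero, add_zero]) (by
        rw [hmap, Matrix.map_zero _ (map_zero C), Matrix.mul_zero, add_zero, ← hs, ← hl]
        simp [hi.1.symm, hi.2.symm])
    refine ⟨c, hc, hlin, 1, one_ne_zero, fun q _ => ?_⟩
    rw [hev, add_zero, hsing]

theorem card_cloneVar {m : ℕ} (hm : 2 ≤ m) : Fintype.card (CloneVar m) = m ^ 2 - 1 := by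
  have h : Fintype.card (CloneVar m) =
      Fintype.card {p : Fin m × Fin m // ¬ p = (ult m hm, ult m hm)} := by
    refine Fintype.card_congr (Equiv.subtypeEquivRight fun p => not_congr ?_)
    rw [Prod.ext_iff, Fin.ext_iff, Fin.ext_iff]
    simp only [ult]
    omega
  rw [h, Fintype.card_subtype_compl, Fintype.card_prod, Fintype.card_fin,
    Fintype.card_subtype_eq, sq]

variable [CharZero k]

theorem finrank_linearSyzygies_polarMap :
    Module.finrank (MvPolynomial (CloneVar m) k) (linearSyzygies (polarMap (clonedDet k m hm)))
      = m ^ 2 - 2 := by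
  have hcard := card_cloneVar hm
  have hsyz := finrank_syzygies (g := polarMap (clonedDet k m hm))
    ⟨cloneSource m hm, polarMap_ne_zero k m hm _⟩
  apply le_antisymm
  · have := Submodule.finrank_mono (linearSyzygies_le_syzygies (polarMap (clonedDet k m hm)))
    omega
  · choose! c hc hlin t ht hev using exists_linear_syzygy_dual k m hm
    let b : {p : CloneVar m // p ≠ cloneSource m hm} →
        linearSyzygies (polarMap (clonedDet k m hm)) := fun p =>
      ⟨c p.1, Submodule.subset_span ⟨hc p.1 p.2, hlin p.1 p.2⟩⟩
    have hb : LinearIndependent (MvPolynomial (CloneVar m) k) b := by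
      let N : Matrix {p : CloneVar m // p ≠ cloneSource m hm}
        {p : CloneVar m // p ≠ cloneSource m hm} (MvPolynomial (CloneVar m) k) :=
        Matrix.of fun p q => c p.1 q.1
      -- At the identity matrix N becomes diagonal with nonzero entries t.
      have hN : N.det ≠ 0 := by
        intro h0
        have h1 := congrArg (aeval (idPoint k m) : _ →ₐ[k] k) h0
        have h2 : (aeval (idPoint k m) : _ →ₐ[k] k).mapMatrix N
            = Matrix.diagonal fun p => t p.1 := by
          ext p q
          refine (hev p.1 p.2 q.1 q.2).trans ?_
          rw [Matrix.diagonal_apply]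
          exact if_congr (by rw [← Subtype.ext_iff, eq_comm]) rfl rfl
        rw [AlgHom.map_det, h2, Matrix.det_diagonal, map_zero] at h1
        exact Finset.prod_ne_zero_iff.mpr (fun p _ => ht p.1 p.2) h1
      refine LinearIndependent.of_comp
        ((LinearMap.funLeft (MvPolynomial (CloneVar m) k) (MvPolynomial (CloneVar m) k)
          (Subtype.val : {p : CloneVar m // p ≠ cloneSource m hm} → CloneVar m)).comp
          (Submodule.subtype _)) ?_
      exact Matrix.linearIndependent_rows_of_det_ne_zero hN
    have h1 := hb.fintype_card_le_finrank
    have h2 : Fintype.card {p : CloneVar m // p ≠ cloneSource m hm} = m ^ 2 - 1 - 1 := by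
      rw [Fintype.card_subtype_compl, Fintype.card_subtype_eq, hcard]
    omega

/-- A linear relation among the partials is an algebraic relation of degree one, and there are none.
-/
theorem linearIndependent_polarMap : LinearIndependent k (polarMap (clonedDet k m hm)) := by
  rw [Fintype.linearIndependent_iff]
  intro a ha i
  have h1 := aeval_polarMap_eq_zero k m hm (∑ p, a p • X p) (by simpa using ha)
  have h2 := congrArg (coeff (Finsupp.single i 1)) h1
  classical
  simpa [coeff_sum, coeff_X, Finsupp.single_left_inj] using h2

theorem linearRank_gradientIdeal :
    HasLinearRank (gradientIdeal (clonedDet k m hm)) (m ^ 2 - 2) ∧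
      HasMaximalLinearRank (gradientIdeal (clonedDet k m hm)) := by
  refine hasMaximalLinearRank_of_finrank (isMinimalFormSystem_of_linearIndependent
    (linearIndependent_polarMap k m hm) (isHomogeneous_polarMap k m hm)) ?_
    (finrank_linearSyzygies_polarMap k m hm)
  have : 2 ^ 2 ≤ m ^ 2 := Nat.pow_le_pow_left hm 2
  rw [card_cloneVar hm]
  omega

end Syzygies

end Cloning

theorem theorem2p3 {k : Type*} [Field k] [CharZero k] (m : ℕ) (hm : 2 ≤ m) :
    Irreducible (Cloning.clonedDet k m hm) ∧
    (Cloning.hessian (Cloning.clonedDet k m hm)).det ≠ 0 ∧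
    (Cloning.HasLinearRank (Cloning.gradientIdeal (Cloning.clonedDet k m hm)) (m ^ 2 - 2) ∧
      Cloning.HasMaximalLinearRank (Cloning.gradientIdeal (Cloning.clonedDet k m hm))) ∧
    Cloning.IsHomaloidal (Cloning.clonedDet k m hm) :=
  ⟨Cloning.irreducible_clonedDet k m hm, Cloning.hessian_clonedDet_ne_zero k m hm,
    Cloning.linearRank_gradientIdeal k m hm, Cloning.isHomaloidal_clonedDet k m hm⟩
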